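/- Let $\mathrm{Top}$ be the category of topological spaces and continuous maps, and let $\mathrm{Hom}_{\mathrm{c}}(\mathrm{Top},\mathrm{Top})$ be the category whose objects are the functors $\mathrm{Top}\to\mathrm{Top}$ that preserve all small colimits and whose morphisms are the natural transformations. A topological topology $(X,\tau)$ consists of a topological space $X$ and a topology $\tau$ on its set $\mathcal{O}(X)$ of open subsets such that the operators $\bigcup:\mathcal{O}(X)^I\to\mathcal{O}(X)$ and $\bigcap:\mathcal{O}(X)^J\to\mathcal{O}(X)$ are continuous for every set $I$ and every finite set $J$, where the powers carry the product topology. A morphism $(X,\tau)\to(Y,\sigma)$ is a continuous map $f:X\to Y$ such that $f^*:(\mathcal{O}(Y),\sigma)\to(\mathcal{O}(X),\tau)$, $V\mapsto f^{-1}(V)$, is continuous. Let $\mathrm{Top}'$ be the resulting category. Then there is an equivalence of categories $$\mathrm{Hom}_{\mathrm{c}}(\mathrm{Top},\mathrm{Top})\simeq\mathrm{Top}'$$ over $\mathrm{Top}$: its composition with the forgetful functor $\mathrm{Top}'\to\mathrm{Top}$, $(X,\tau)\mapsto X$, is naturally isomorphic to the functor $F\mapsto F(1)$ that evaluates at the one-point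 space $1$. -/

import Mathlib

open CategoryTheory TopologicalSpace

universe u

/-- The category of cocontinuous functors (functors preserving all small colimits) from the category
of topological spaces to itself, with all natural transformations as morphisms. -/
abbrev CocontinuousEndofunctor : Type (u + 1) :=
  ObjectProperty.FullSubcategory
    (fun F : TopCat.{u} ⥤ TopCat.{u} => Limits.PreservesColimitsOfSize.{u, u} F)

/-- A topological topology: a topological space together with a topology on its set of open subsets
such that arbitrary unions and finite intersections are continuous, where the powers of the
set of open subsets carry the product topology. -/
structure TopologicalTopology : Type (u + 1) where
  /-- the underlying space -/
  space : TopCat.{u}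
  /-- the topology on the set of open subsets -/
  topology : TopologicalSpace (Opens space)
  /-- arbitrary unions are continuous -/
  continuous_union : ∀ I : Type u,
    Continuous fun U : I → Opens space => ⨆ i, U i
  /-- finite intersections are continuous -/
  continuous_inter : ∀ (J : Type u) [Finite J],
    Continuous fun U : J → Opens space => ⨅ j, U j

namespace TopologicalTopology

instance (X : TopologicalTopology.{u}) : TopologicalSpace (Opens X.space) := X.topology

/-- A morphism of topological topologies: a continuous map for which taking preimages of open sets
is continuous with respect to the given topologies on the sets of open subsets. -/
@[ext]
structure Hom (X Y : TopologicalTopology.{u}) : Type u where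
  /-- the underlying continuous map -/
  map : X.space ⟶ Y.space
  /-- the preimage operation is continuous -/
  continuous_preimage : Continuous fun V : Opens Y.space => Opens.comap map.hom V

instance : Category.{u} TopologicalTopology.{u} where
  Hom := Hom
  id X := ⟨𝟙 X.space, continuous_id⟩
  comp f g := ⟨f.map ≫ g.map, f.continuous_preimage.comp g.continuous_preimage⟩

/-- The forgetful functor from topological topologies to topological spaces. -/
def forgetToTop : TopologicalTopology.{u} ⥤ TopCat.{u} where
  obj X := X.space
  map f := f.map

end TopologicalTopology

/-- Evaluation of a cocontinuous functor at the one-point space. -/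
def evalAtPoint : CocontinuousEndofunctor.{u} ⥤ TopCat.{u} :=
  ObjectProperty.ι _ ⋙ (evaluation TopCat.{u} TopCat.{u}).obj (TopCat.of PUnit.{u + 1})

/-! ### Cocontinuous functors as left adjoints -/

namespace TopCat

/-! The inverse equivalence sends `(X, τ)` to `Z ↦ Z × X`, where the opens of `Z × X` are the
continuous maps `Z → (𝒪(X), τ)`; the axioms on `τ` make this a topology. It is left adjoint to a
space of maps, hence cocontinuous.

Conversely, a cocontinuous `F` has a right adjoint by the special adjoint functor theorem, so maps
`F Z ⟶ K` are the continuous families, indexed by `Z`, of maps `F 1 ⟶ K`. For `K` the Sierpinski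
space this gives `τ` on `𝒪(F 1)` and describes the opens of `F Z`. For `K` the two-point indiscrete
space it describes the subsets of `F Z`. The topology on subsets of `F 1` turns out to be indiscrete
(`continuous_set_of_continuous_liminf`), so `F Z` has underlying set `Z × F 1` (`bijective_map_pt`).
-/

/-- A continuous map factors through a surjection as soon as it does so on points and on open
sets. -/
lemma exists_comp_eq_of_surjective {X A B : TopCat.{u}} (p : X ⟶ A) (q : X ⟶ B)
    (hp : Function.Surjective p) (h : ∀ x y, p x = p y → q x = q y)
    (ho : ∀ V : Set B, IsOpen V → ∃ U : Set A, IsOpen U ∧ p ⁻¹' U = q ⁻¹' V) :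
    ∃ g : A ⟶ B, p ≫ g = q := by
  have hfac : ∀ x, q (Function.surjInv hp (p x)) = q x := fun x =>
    h _ _ (Function.surjInv_eq hp (p x))
  refine ⟨ofHom ⟨fun a => q (Function.surjInv hp a), ⟨fun V hV => ?_⟩⟩, ?_⟩
  · obtain ⟨U, hU, hUV⟩ := ho V hV
    convert hU
    ext a
    have := Set.ext_iff.1 hUV (Function.surjInv hp a)
    simpa [Function.surjInv_eq hp a] using this.symm
  · ext x
    exact hfac x

/-- Needed for the adjoint functor theorem. A quotient object of `X` is a surjection, determined by
its kernel relation and the preimages of its open sets: a small amount of data on `X`. -/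
instance wellPowered_op : WellPowered.{u} TopCat.{u}ᵒᵖ where
  subobject_small X := by
    have hsurj (S : Subobject X) : Function.Surjective S.arrow.unop :=
      (epi_iff_surjective _).1 inferInstance
    let code (S : Subobject X) : Set (X.unop × X.unop) × Set (Set X.unop) :=
      ({z | S.arrow.unop z.1 = S.arrow.unop z.2},
        {T | ∃ U, IsOpen U ∧ S.arrow.unop ⁻¹' U = T})
    have hle (S T : Subobject X) (h : code S = code T) : S ≤ T := by
      obtain ⟨h₁, h₂⟩ := Prod.ext_iff.1 h
      obtain ⟨g, hg⟩ := exists_comp_eq_of_surjective T.arrow.unop S.arrow.unop (hsurj T)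
        (fun x y hxy => (Set.ext_iff.1 h₁ (x, y)).2 hxy)
        (fun V hV => (Set.ext_iff.1 h₂ (S.arrow.unop ⁻¹' V)).1 ⟨V, hV, rfl⟩)
      exact Subobject.le_of_comm g.op (Quiver.Hom.unop_inj hg)
    exact small_of_injective (f := code) fun S T h => le_antisymm (hle S T h) (hle T S h.symm)

/-- The one-point space. -/
abbrev point : TopCat.{u} := TopCat.of PUnit.{u + 1}

/-- The inclusion of a point. -/
def pt {Z : TopCat.{u}} (z : Z) : point.{u} ⟶ Z := ofHom (ContinuousMap.const _ z)

@[simp]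
lemma pt_comp {Z Z' : TopCat.{u}} (z : Z) (h : Z ⟶ Z') : pt z ≫ h = pt (h z) := rfl

lemma isSeparating_point : (ObjectProperty.singleton point.{u}).IsSeparating := by
  intro X Y f g h
  ext x
  have := h point (by simp) (pt x)
  exact ConcreteCategory.congr_hom this PUnit.unit

/-- Cocontinuous functors out of the category of topological spaces are left adjoints. -/
lemma isLeftAdjoint_of_preservesColimits {C : Type*} [Category.{u} C] (F : TopCat.{u} ⥤ C)
    [Limits.PreservesColimitsOfSize.{u, u} F] : F.IsLeftAdjoint :=
  isLeftAdjoint_of_preservesColimits_of_isSeparating isSeparating_point F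

/-- For a left adjoint `F` and a space `K`, the maps `F.obj Z ⟶ K` are the continuous families of
maps `F.obj point ⟶ K` for a suitable topology on the latter. -/
lemma exists_topology_hom (F : TopCat.{u} ⥤ TopCat.{u}) [F.IsLeftAdjoint] (K : TopCat.{u}) :
    ∃ _ : TopologicalSpace (F.obj point ⟶ K),
      (∀ (Z : TopCat.{u}) (g : F.obj Z ⟶ K), Continuous fun z : Z => F.map (pt z) ≫ g) ∧
      (∀ (Z : TopCat.{u}) (φ : Z → (F.obj point ⟶ K)), Continuous φ →
        ∃ g : F.obj Z ⟶ K, ∀ z, F.map (pt z) ≫ g = φ z) ∧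
      (∀ (Z : TopCat.{u}) (g g' : F.obj Z ⟶ K),
        (∀ z : Z, F.map (pt z) ≫ g = F.map (pt z) ≫ g') → g = g') := by
  -- `b` identifies maps `F.obj point ⟶ K` with points of `G.obj K`, and the topology is pulled back
  -- from there.
  let adj := Adjunction.ofIsLeftAdjoint F
  let G := F.rightAdjoint
  let b : (F.obj point ⟶ K) → G.obj K := fun k => adj.homEquiv _ _ k PUnit.unit
  have hb {Z : TopCat.{u}} (g : F.obj Z ⟶ K) (z : Z) :
      b (F.map (pt z) ≫ g) = adj.homEquiv _ _ g z := by
    simp only [b, adj.homEquiv_naturality_left]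
    rfl
  have hbi : Function.Injective b := fun k k' h => (adj.homEquiv _ _).injective (by
    ext ⟨⟩
    exact h)
  refine ⟨.induced b inferInstance, fun Z g => continuous_induced_rng.2 ?_, fun Z φ hφ => ?_,
    fun Z g g' h => (adj.homEquiv _ _).injective ?_⟩
  · simp only [Function.comp_def, hb]
    exact (adj.homEquiv _ _ g).hom.continuous
  · refine ⟨(adj.homEquiv _ _).symm (ofHom ⟨b ∘ φ, continuous_induced_rng.1 hφ⟩),
      fun z => hbi ?_⟩
    rw [hb, Equiv.apply_symm_apply]
    rfl
  · ext z
    rw [← hb, ← hb, h z]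

end TopCat

/-! ### The product with a topological topology and its right adjoint -/

namespace TopologicalTopology

open TopCat (point pt ofHom)

variable (X Y : TopologicalTopology.{u})

lemma continuous_sup : Continuous fun U : Opens X.space × Opens X.space => U.1 ⊔ U.2 := by
  have h := (X.continuous_union (ULift.{u} Bool)).comp
    (continuous_pi fun i => by
      cases i.down
      exacts [continuous_fst, continuous_snd] :
      Continuous fun (U : Opens X.space × Opens X.space) (i : ULift.{u} Bool) =>
        Bool.rec (motive := fun _ => Opens X.space) U.1 U.2 i.down)
  refine h.congr fun U => ?_
  change ⨆ i : ULift.{u} Bool, _ = _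
  rw [iSup_ulift, iSup_bool_eq, sup_comm]

lemma continuous_inf : Continuous fun U : Opens X.space × Opens X.space => U.1 ⊓ U.2 := by
  have h := (X.continuous_inter (ULift.{u} Bool)).comp
    (continuous_pi fun i => by
      cases i.down
      exacts [continuous_fst, continuous_snd] :
      Continuous fun (U : Opens X.space × Opens X.space) (i : ULift.{u} Bool) =>
        Bool.rec (motive := fun _ => Opens X.space) U.1 U.2 i.down)
  refine h.congr fun U => ?_
  change ⨅ i : ULift.{u} Bool, _ = _
  rw [iInf_ulift, iInf_bool_eq, inf_comm]

/-- The underlying set of the product of a space with a topological topology. -/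
def Product (Z : TopCat.{u}) : Type u := Z × X.space

/-- The open subsets of the product of `Z` with `X` are the continuous maps from `Z` to the space
of open subsets of `X`. -/
instance (Z : TopCat.{u}) : TopologicalSpace (X.Product Z) where
  IsOpen W := ∃ φ : Z → Opens X.space, Continuous φ ∧ ∀ z x, (z, x) ∈ W ↔ x ∈ φ z
  isOpen_univ := ⟨fun _ => ⊤, continuous_const, fun _ _ => iff_of_true trivial trivial⟩
  isOpen_inter := by
    rintro _ _ ⟨φ, hφ, h⟩ ⟨ψ, hψ, h'⟩
    exact ⟨fun z => φ z ⊓ ψ z, X.continuous_inf.comp (hφ.prodMk hψ), fun z x =>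
      and_congr (h z x) (h' z x)⟩
  isOpen_sUnion := by
    intro S hS
    choose! φ hφ h using hS
    refine ⟨fun z => ⨆ W : S, φ W z,
      (X.continuous_union S).comp (continuous_pi fun W => hφ W W.2), fun z x => ?_⟩
    simp only [Opens.mem_iSup, Subtype.exists, exists_prop]
    exact exists_congr fun W => and_congr_right fun hW => h W hW z x

variable {X Y}

lemma Hom.continuous_product_map (f : X ⟶ Y) {Z Z' : TopCat.{u}} (h : Z ⟶ Z') :
    Continuous (X := X.Product Z) (Y := Y.Product Z') fun w => (h w.1, f.map w.2) := by
  refine ⟨fun W hW => ?_⟩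
  obtain ⟨φ, hφ, hW⟩ := hW
  exact ⟨fun z => Opens.comap f.map.hom (φ (h z)),
    f.continuous_preimage.comp (hφ.comp h.hom.continuous), fun z x => hW _ _⟩

variable (X Y)

/-- The endofunctor taking the product with a topological topology. -/
@[simps]
def productFunctor : TopCat.{u} ⥤ TopCat.{u} where
  obj Z := TopCat.of (X.Product Z)
  map h := ofHom ⟨fun w => (h w.1, w.2), Hom.continuous_product_map (𝟙 X) h⟩

/-- The transformation of product functors given by a morphism of topological topologies. -/
@[simps]
def Hom.productMap {X Y : TopologicalTopology.{u}} (f : X ⟶ Y) :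
    X.productFunctor ⟶ Y.productFunctor where
  app Z := ofHom ⟨fun w => (w.1, f.map w.2), Hom.continuous_product_map f (𝟙 Z)⟩

/-- The set of continuous maps from a topological topology to a space. -/
def Maps (K : TopCat.{u}) : Type u := X.space ⟶ K

/-- The coarsest topology for which the preimage of any given open subset depends continuously on
the map. -/
instance (K : TopCat.{u}) : TopologicalSpace (X.Maps K) :=
  .induced (fun f (V : Opens K) => Opens.comap (TopCat.Hom.hom f) V) inferInstance

variable {X} in
lemma continuous_maps_iff {T : Type*} [TopologicalSpace T] {K : TopCat.{u}} {g : T → X.Maps K} :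
    Continuous g ↔ ∀ V : Opens K, Continuous fun t => Opens.comap (TopCat.Hom.hom (g t)) V := by
  rw [continuous_induced_rng, continuous_pi_iff]
  rfl

/-- The right adjoint of the product functor. -/
@[simps]
def mapsFunctor : TopCat.{u} ⥤ TopCat.{u} where
  obj K := TopCat.of (X.Maps K)
  map h := ofHom ⟨fun f => (f ≫ h : X.space ⟶ _), continuous_maps_iff.2 fun V =>
    continuous_maps_iff.1 continuous_id (Opens.comap h.hom V)⟩

-- The exponential law: the preimage of `V` under `g` is open exactly when the preimage of `V` under
-- `h z` is open for each `z` and varies continuously with `z`.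
variable {X} in
lemma continuous_product_iff {Z K : TopCat.{u}} {g : X.Product Z → K} :
    Continuous g ↔ ∃ h : Z → X.Maps K, Continuous h ∧
      ∀ z x, TopCat.Hom.hom (h z) x = g (z, x) := by
  constructor
  · intro hg
    have hz (z : Z) : Continuous fun x : X.space => g (z, x) := ⟨fun V hV => by
      obtain ⟨φ, -, h⟩ := hg.isOpen_preimage V hV
      convert (φ z).isOpen
      ext x
      exact h z x⟩
    refine ⟨fun z => ofHom ⟨_, hz z⟩, continuous_maps_iff.2 fun V => ?_, fun _ _ => rfl⟩
    obtain ⟨φ, hφ, h⟩ := hg.isOpen_preimage V V.isOpen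
    convert hφ with z
    ext x
    exact h z x
  · rintro ⟨h, hh, heq⟩
    refine ⟨fun V hV => ⟨_, continuous_maps_iff.1 hh ⟨V, hV⟩, fun z x => ?_⟩⟩
    change g (z, x) ∈ V ↔ TopCat.Hom.hom (h z) x ∈ V
    rw [heq]

/-- The adjunction between products with a topological topology and spaces of maps. -/
noncomputable def productAdjunction : X.productFunctor ⊣ X.mapsFunctor :=
  Adjunction.mkOfHomEquiv
    { homEquiv := fun Z K =>
        { toFun := fun g => ofHom
            ⟨(continuous_product_iff.1 g.hom.continuous).choose,
              (continuous_product_iff.1 g.hom.continuous).choose_spec.1⟩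
          invFun := fun h => ofHom ⟨fun w => TopCat.Hom.hom (h w.1 : X.space ⟶ K) w.2,
            continuous_product_iff.2 ⟨h, h.hom.continuous, fun _ _ => rfl⟩⟩
          left_inv := fun g => by
            ext w
            exact (continuous_product_iff.1 g.hom.continuous).choose_spec.2 w.1 w.2
          right_inv := fun h => by
            ext z
            refine TopCat.hom_ext (ContinuousMap.ext fun x => ?_)
            exact (continuous_product_iff.1 (continuous_product_iff.2
              ⟨h, h.hom.continuous, fun _ _ => rfl⟩)).choose_spec.2 z x }
      homEquiv_naturality_left_symm := fun _ _ => rfl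
      homEquiv_naturality_right := fun {Z K K'} f g => by
        ext z
        refine TopCat.hom_ext (ContinuousMap.ext fun x => ?_)
        refine ((continuous_product_iff.1 (f ≫ g).hom.continuous).choose_spec.2 z x).trans ?_
        exact congrArg g
          ((continuous_product_iff.1 f.hom.continuous).choose_spec.2 z x).symm }

/-- A topological topology gives a cocontinuous endofunctor. -/
@[simps]
def toCocontinuous : TopologicalTopology.{u} ⥤ CocontinuousEndofunctor.{u} where
  obj X := ⟨X.productFunctor, X.productAdjunction.leftAdjoint_preservesColimits⟩
  map f := ObjectProperty.homMk f.productMap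

/-! ### Full faithfulness -/

variable {X Y}

/-- Naturality along the inclusion of `z` fixes the first coordinate and reduces `α` to its
component at the point. -/
lemma productFunctor_naturality (α : X.productFunctor ⟶ Y.productFunctor) {Z : TopCat.{u}}
    (z : Z) (x : X.space) :
    α.app Z (z, x) = (z, (α.app point (PUnit.unit, x)).2) :=
  ConcreteCategory.congr_hom (α.naturality (pt z)) (PUnit.unit, x)

instance : toCocontinuous.{u}.Faithful where
  map_injective {X Y f g} h := by
    refine Hom.ext ?_
    ext x
    have h' : f.productMap.app point = g.productMap.app point := by
      exact congrArg (fun a : toCocontinuous.obj X ⟶ toCocontinuous.obj Y => a.hom.app point) h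
    exact congrArg Prod.snd (ConcreteCategory.congr_hom h' (PUnit.unit, x))

lemma isOpen_slice {Z : TopCat.{u}} {W : Set (X.Product Z)} (hW : IsOpen W) (z : Z) :
    IsOpen {x : X.space | ((z, x) : X.Product Z) ∈ W} := by
  obtain ⟨φ, -, h⟩ := hW
  convert (φ z).isOpen
  ext x
  exact h z x

/-- Every transformation of product functors comes from a morphism. -/
lemma exists_productMap_eq (α : X.productFunctor ⟶ Y.productFunctor) :
    ∃ f : X ⟶ Y, f.productMap = α := by
  let f (x : X.space) : Y.space := (α.app point (PUnit.unit, x)).2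
  have hf : Continuous f := ⟨fun V hV => by
    have hW : IsOpen {w : Y.Product point | w.2 ∈ V} :=
      ⟨fun _ => ⟨V, hV⟩, continuous_const, fun _ _ => Iff.rfl⟩
    exact isOpen_slice (hW.preimage (α.app point).hom.continuous) PUnit.unit⟩
  refine ⟨⟨ofHom ⟨f, hf⟩, ?_⟩, ?_⟩
  -- The membership relation is the universal open set; its preimage under `α` has slice `f ⁻¹' V`
  -- at `V`.
  · let Z : TopCat.{u} := TopCat.of (Opens Y.space)
    have hW : IsOpen {w : Y.Product Z | w.2 ∈ (w.1 : Opens Y.space)} :=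
      ⟨fun V => V, continuous_id, fun _ _ => Iff.rfl⟩
    obtain ⟨φ, hφ, h⟩ := hW.preimage (α.app Z).hom.continuous
    convert hφ with V
    ext x
    refine Iff.trans ?_ (h V x)
    change f x ∈ V ↔ (α.app Z (V, x)).2 ∈ (α.app Z (V, x)).1
    rw [productFunctor_naturality]
  · ext Z w
    exact (productFunctor_naturality α w.1 w.2).symm

instance : toCocontinuous.{u}.Full where
  map_surjective {X Y} α := by
    obtain ⟨f, hf⟩ := exists_productMap_eq α.hom
    exact ⟨f, ObjectProperty.hom_ext _ hf⟩

/-- The value of the product functor at a point. -/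
def productPointIso (X : TopologicalTopology.{u}) : X.productFunctor.obj point ≅ X.space where
  hom := ofHom ⟨fun w => w.2, ⟨fun V hV => ⟨fun _ => ⟨V, hV⟩, continuous_const,
    fun _ _ => Iff.rfl⟩⟩⟩
  inv := ofHom ⟨fun x => (PUnit.unit, x), ⟨fun _ hW => isOpen_slice hW PUnit.unit⟩⟩

/-- Evaluating product functors at a point recovers the underlying space. -/
def toCocontinuousEvalIso : toCocontinuous.{u} ⋙ evalAtPoint.{u} ≅ forgetToTop.{u} :=
  NatIso.ofComponents productPointIso fun _ => rfl

end TopologicalTopology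

/-! ### Open sets and subsets of the values of a left adjoint -/

namespace TopCat

/-- The Sierpinski space. -/
abbrev sierpinski : TopCat.{u} := TopCat.of (ULift.{u} Prop)

/-- Maps to the Sierpinski space are open subsets. -/
def homSierpinskiEquiv (A : TopCat.{u}) : (A ⟶ sierpinski.{u}) ≃ Opens A where
  toFun g := ⟨{a | (g a).down}, continuous_Prop.1 (continuous_uliftDown.comp g.hom.continuous)⟩
  invFun U := ofHom ⟨fun a => ⟨a ∈ U⟩, continuous_uliftUp.comp (continuous_Prop.2 U.isOpen)⟩

/-- The underlying set of the two-point indiscrete space. -/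
def IndiscreteProp : Type u := ULift.{u} Prop

instance : TopologicalSpace IndiscreteProp.{u} := ⊤

instance : IndiscreteTopology IndiscreteProp.{u} := ⟨rfl⟩

/-- The two-point indiscrete space. -/
abbrev indiscrete : TopCat.{u} := TopCat.of IndiscreteProp.{u}

/-- Maps to the two-point indiscrete space are subsets. -/
def homIndiscreteEquiv (A : TopCat.{u}) : (A ⟶ indiscrete.{u}) ≃ Set A where
  toFun g := {a | ULift.down (g a)}
  invFun U := ofHom ⟨fun a => ULift.up (a ∈ U), continuous_top⟩

variable (F : TopCat.{u} ⥤ TopCat.{u}) [F.IsLeftAdjoint]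

lemma exists_topology_opens :
    ∃ _ : TopologicalSpace (Opens (F.obj point)),
      (∀ (Z : TopCat.{u}) (W : Opens (F.obj Z)),
        Continuous fun z : Z => Opens.comap (F.map (pt z)).hom W) ∧
      (∀ (Z : TopCat.{u}) (φ : Z → Opens (F.obj point)), Continuous φ →
        ∃ W : Opens (F.obj Z), ∀ z, Opens.comap (F.map (pt z)).hom W = φ z) := by
  obtain ⟨_, h₁, h₂, -⟩ := exists_topology_hom F sierpinski
  let e := homSierpinskiEquiv (F.obj point)
  refine ⟨.induced e.symm inferInstance, fun Z W => continuous_induced_rng.2 ?_,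
    fun Z φ hφ => ?_⟩
  · exact h₁ Z ((homSierpinskiEquiv _).symm W)
  · obtain ⟨g, hg⟩ := h₂ Z (e.symm ∘ φ) (continuous_induced_rng.1 hφ)
    exact ⟨homSierpinskiEquiv _ g, fun z => e.symm.injective (hg z)⟩

/-- A topology on the subsets of a set for which the limes inferior of sequences of subsets is
continuous has no nontrivial open sets. -/
lemma continuous_set_of_continuous_liminf {X T : Type*} [TopologicalSpace (Set X)]
    [TopologicalSpace T]
    (h : Continuous fun U : ULift.{u} ℕ → Set X =>
      {x | ∀ᶠ n : ℕ in Filter.atTop, x ∈ U (ULift.up n)}) (φ : T → Set X) : Continuous φ := by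
  -- The sequences `A, …, A, B, B, …` with `k` initial terms `A` converge to the constant sequence
  -- `A` as `k → ∞`, yet each has limes inferior `B`. Continuity puts `B` in every neighbourhood of
  -- `A`.
  have key (A B : Set X) : B ⤳ A := by
    let s (k : ℕ) (n : ULift.{u} ℕ) : Set X := if n.down < k then A else B
    have hs : Filter.Tendsto s Filter.atTop (nhds fun _ => A) := by
      refine tendsto_pi_nhds.2 fun n => tendsto_const_nhds.congr' ?_
      filter_upwards [Filter.eventually_gt_atTop n.down] with k hk
      simp [s, hk]
    have hl := (h.tendsto fun _ => A).comp hs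
    have hB : ∀ k, {x | ∀ᶠ n : ℕ in Filter.atTop, x ∈ s k (ULift.up n)} = B := fun k => by
      ext x
      have : ∀ᶠ n : ℕ in Filter.atTop, (x ∈ s k (ULift.up n) ↔ x ∈ B) := by
        filter_upwards [Filter.eventually_ge_atTop k] with n hn
        simp [s, hn.not_gt]
      exact (Filter.eventually_congr this).trans Filter.eventually_const
    have hA : {x | ∀ᶠ _n : ℕ in Filter.atTop, x ∈ A} = A := by
      ext x
      exact Filter.eventually_const
    rw [hA, Function.comp_def, funext hB] at hl
    refine specializes_iff_forall_open.2 fun U hU hAU => ?_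
    exact Filter.eventually_const.1 (hl.eventually_mem (hU.mem_nhds hAU))
  refine ⟨fun U hU => ?_⟩
  obtain rfl | ⟨A, hA⟩ := U.eq_empty_or_nonempty
  · exact isOpen_empty
  · have : U = Set.univ := Set.eq_univ_of_forall fun B => (key A B).mem_open hU hA
    rw [this]
    exact isOpen_univ

/-- Any operation on sequences of subsets that commutes with preimages is continuous, as its
application to the universal sequence shows. The limes inferior is one, so every family `φ` is
continuous. -/
lemma existsUnique_preimage_eq (Z : TopCat.{u}) (φ : Z → Set (F.obj point)) :
    ∃! W : Set (F.obj Z), ∀ z, F.map (pt z) ⁻¹' W = φ z := by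
  obtain ⟨_, h₁, h₂, h₃⟩ := exists_topology_hom F indiscrete
  let e := homIndiscreteEquiv (F.obj point)
  let _ : TopologicalSpace (Set (F.obj point)) := .induced e.symm inferInstance
  have hc (Z : TopCat.{u}) (W : Set (F.obj Z)) : Continuous fun z : Z => F.map (pt z) ⁻¹' W :=
    continuous_induced_rng.2 (h₁ Z ((homIndiscreteEquiv _).symm W))
  have hex (Z : TopCat.{u}) (φ : Z → Set (F.obj point)) (hφ : Continuous φ) :
      ∃ W : Set (F.obj Z), ∀ z, F.map (pt z) ⁻¹' W = φ z := by
    obtain ⟨g, hg⟩ := h₂ Z (e.symm ∘ φ) (continuous_induced_rng.1 hφ)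
    exact ⟨homIndiscreteEquiv _ g, fun z => e.symm.injective (hg z)⟩
  have hlim : Continuous fun U : ULift.{u} ℕ → Set (F.obj point) =>
      {x | ∀ᶠ n : ℕ in Filter.atTop, x ∈ U (ULift.up n)} := by
    -- `W n` is the universal `n`-th term: its restriction along the point `U` of `P` is `U n`.
    let P : TopCat.{u} := TopCat.of (ULift.{u} ℕ → Set (F.obj point))
    choose W hW using fun n => hex P (fun U => U n) (continuous_apply n)
    convert hc P {w | ∀ᶠ n : ℕ in Filter.atTop, w ∈ W (ULift.up n)} with U
    ext x
    simp [← hW]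
  obtain ⟨W, hW⟩ := hex Z φ (continuous_set_of_continuous_liminf hlim φ)
  refine ⟨W, hW, fun W' hW' => (homIndiscreteEquiv _).symm.injective (h₃ Z _ _ fun z => ?_)⟩
  exact congrArg e.symm ((hW' z).trans (hW z).symm)

/-- The map `(z, x) ↦ F(z)(x)` is bijective. -/
lemma bijective_map_pt (Z : TopCat.{u}) :
    Function.Bijective fun w : Z × F.obj point => F.map (pt w.1) w.2 := by
  constructor
  · rintro ⟨z, x⟩ ⟨z', x'⟩ h
    -- `W` is the subset whose only point of the form `F(y)(x')` comes from `(z, x)`.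
    obtain ⟨W, hW, -⟩ := existsUnique_preimage_eq F Z fun y => {x' | (y, x') = (z, x)}
    have h₁ : F.map (pt z) x ∈ W := (Set.ext_iff.1 (hW z) x).2 rfl
    have h₂ : F.map (pt z') x' ∈ W := Set.mem_of_eq_of_mem (Eq.symm h) h₁
    exact ((Set.ext_iff.1 (hW z') x').1 h₂).symm
  · intro w
    by_contra! hw
    -- If `w` were missed, `∅` and `{w}` would have the same restrictions.
    have h := (existsUnique_preimage_eq F Z fun _ => ∅).unique
      (y₁ := ∅) (y₂ := {w}) (fun _ => rfl)
      (fun z => Set.eq_empty_of_forall_notMem fun x hx => hw (z, x) hx)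
    exact (Set.ext_iff.1 h w).2 rfl

end TopCat

/-! ### Essential surjectivity and the equivalence -/

namespace TopologicalTopology

open TopCat (point pt ofHom)

/-- A cocontinuous endofunctor is the product with a topological topology. -/
lemma exists_productFunctor_iso (F : TopCat.{u} ⥤ TopCat.{u}) [F.IsLeftAdjoint] :
    ∃ X : TopologicalTopology.{u}, Nonempty (X.productFunctor ≅ F) := by
  obtain ⟨t, h₁, h₂⟩ := TopCat.exists_topology_opens F
  let X : TopologicalTopology.{u} :=
    { space := F.obj point
      topology := t
      continuous_union := fun I => by
        -- The union of the universal open sets `W i` over `P` is open in `F.obj P`; the family of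
        -- its restrictions is the union operator.
        let P : TopCat.{u} := TopCat.of (I → Opens (F.obj point))
        choose W hW using fun i => h₂ P (fun U => U i) (continuous_apply i)
        convert h₁ P (⨆ i, W i) with U
        simp [← hW]
      continuous_inter := fun J _ => by
        let P : TopCat.{u} := TopCat.of (J → Opens (F.obj point))
        choose W hW using fun i => h₂ P (fun U => U i) (continuous_apply i)
        -- Preimages need not commute with infinite infima of open sets, which are interiors, so the
        -- infimum is rewritten as a finite one.
        have := Fintype.ofFinite J
        convert h₁ P (⨅ i, W i) with U
        rw [← Finset.inf_univ_eq_iInf, ← Finset.inf_univ_eq_iInf, map_finset_inf]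
        exact congrArg _ (funext fun i => (hW i U).symm) }
  let θ (Z : TopCat.{u}) (w : X.Product Z) : F.obj Z := F.map (pt w.1) w.2
  have hθ (Z : TopCat.{u}) : Topology.IsInducing (θ Z) := by
    refine ⟨TopologicalSpace.ext_iff.2 fun S => ⟨fun hS => ?_, ?_⟩⟩
    · obtain ⟨φ, hφ, h⟩ := hS
      obtain ⟨W, hW⟩ := h₂ Z φ hφ
      refine ⟨W, W.isOpen, ?_⟩
      ext ⟨z, x⟩
      exact (SetLike.ext_iff.1 (hW z) x).trans (h z x).symm
    · rintro ⟨W, hW, rfl⟩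
      exact ⟨_, h₁ Z ⟨W, hW⟩, fun _ _ => Iff.rfl⟩
  let ε (Z : TopCat.{u}) : X.productFunctor.obj Z ≅ F.obj Z :=
    TopCat.isoOfHomeo ((Equiv.ofBijective (θ Z)
      (TopCat.bijective_map_pt F Z)).toHomeomorphOfIsInducing (hθ Z))
  refine ⟨X, ⟨NatIso.ofComponents ε fun {Z Z'} h => ?_⟩⟩
  ext w
  change F.map (pt (h w.1)) w.2 = F.map h (F.map (pt w.1) w.2)
  rw [← TopCat.pt_comp, F.map_comp]
  rfl

instance : toCocontinuous.{u}.EssSurj where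
  mem_essImage F := by
    have := F.property
    have := TopCat.isLeftAdjoint_of_preservesColimits F.obj
    obtain ⟨X, ⟨i⟩⟩ := exists_productFunctor_iso F.obj
    exact ⟨X, ⟨ObjectProperty.isoMk _ i⟩⟩

instance : toCocontinuous.{u}.IsEquivalence where

end TopologicalTopology

theorem theorem8p8 :
    ∃ e : CocontinuousEndofunctor.{u} ≌ TopologicalTopology.{u},
      Nonempty (e.functor ⋙ TopologicalTopology.forgetToTop.{u} ≅ evalAtPoint.{u}) := by
  let e := TopologicalTopology.toCocontinuous.{u}.asEquivalence
  exact ⟨e.symm, ⟨(Functor.isoWhiskerLeft e.inverse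
    TopologicalTopology.toCocontinuousEvalIso.symm).trans
      ((Functor.associator _ _ _).symm.trans ((Functor.isoWhiskerRight e.counitIso _).trans
        (Functor.leftUnitor _)))⟩⟩
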